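/- Let $\mathcal L\subseteq\{+,-,0\}^E$ be the set of covectors of an oriented matroid on a finite ground set $E$, ordered componentwise with $0<+$ and $0<-$ (and $+,-$ incomparable); the maximal covectors are called topes. For $X\in\mathcal L$ let $\overline X=\{Y\in\mathcal L: Y\le X\}$, and let the corank of $X$ (and of $\overline X$) be the greatest length of a chain in $\mathcal L$ with smallest element $X$, that is, the rank of $\mathcal L$ minus the rank of $X$. Let $\mathcal G$ be the graph whose vertices are the topes, where distinct topes $S,T$ are adjacent if $\overline S\cap\overline T=\overline X$ for some covector $X$ of corank $1$. A gallery from a tope $Q$ to a tope $R$ is a sequence $Q=R_0,R_1,\ldots,R_k=R$ of topes such that $R_{i-1}$ and $R_i$ are adjacent in $\mathcal G$ for $1\le i\le k$; its length is $k$. It is reduced if it has minimal length among all galleries from $Q$ to $R$. A polygon is a cycle in $\mathcal G$ whose vertices are exactly the topes $T$ with $\overline X\subseteq\overline T$, for some covector $X$ of corank $2$. A braid move replaces a consecutive subsequence $Q_0,\ldots,Q_m$ of a gallery by a sequence $Q'_0,\ldots,Q'_m$ with $Q'_0=Q_0$ and $Q'_m=Q_m$, where the cycle $Q_0,Q_1,\ldots,Q_m,Q'_{m-1},\ldots,Q'_1,Q'_0$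 is a polygon. A nil move replaces a consecutive subsequence $Q_0,Q_1,Q_2$ with $Q_0=Q_2$ by the single entry $Q_0$. Theorem. Every oriented matroid is path convex: for all topes $Q,R$, every gallery $\gamma$ from $Q$ to $R$, and every reduced gallery $\rho$ from $Q$ to $R$, the gallery $\gamma$ can be transformed into $\rho$ by a finite (possibly empty) sequence of braid moves and nil moves. -/

import Mathlib

/-- The separation set `S(X, Y)` of two sign vectors: the positions at which they have opposite
nonzero signs. -/
def signSep {E : Type*} (X Y : E → SignType) : Set E :=
  {e | X e ≠ 0 ∧ X e = -Y e}

/-- The composition `X ∘ Y` of two sign vectors: `X e` where this is nonzero, and `Y e` elsewhere. -/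
def signComp {E : Type*} (X Y : E → SignType) : E → SignType :=
  fun e => if X e = 0 then Y e else X e

/-- An oriented matroid on the ground set `E`, given by its set of covectors
(the standard covector axioms). -/
structure OrientedMatroid (E : Type*) where
  /-- the set of covectors -/
  covectors : Set (E → SignType)
  zero_mem : (0 : E → SignType) ∈ covectors
  neg_mem : ∀ X ∈ covectors, -X ∈ covectors
  comp_mem : ∀ X ∈ covectors, ∀ Y ∈ covectors, signComp X Y ∈ covectors
  /-- covector elimination -/
  elim : ∀ X ∈ covectors, ∀ Y ∈ covectors, ∀ e ∈ signSep X Y,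
    ∃ Z ∈ covectors, Z e = 0 ∧ ∀ f, f ∉ signSep X Y → Z f = signComp X Y f

namespace OrientedMatroid

/-- A covector of `L`. This is a structure and not a subtype so that it does not inherit the
pointwise order coming from `-1 < 0 < 1`. -/
@[ext]
structure Covector {E : Type*} (L : OrientedMatroid E) where
  /-- the underlying sign vector -/
  val : E → SignType
  mem : val ∈ L.covectors

/-- The order of the face lattice: `X ≤ Y` when `Y` agrees with `X` wherever `X` is nonzero, i.e.
the componentwise order in which `0 < +` and `0 < -`, with `+` and `-` incomparable. -/
instance {E : Type*} (L : OrientedMatroid E) : PartialOrder L.Covector where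
  le X Y := ∀ e, X.val e = 0 ∨ X.val e = Y.val e
  le_refl _ _ := Or.inr rfl
  le_trans X Y Z h₁ h₂ e := by
    rcases h₁ e with h | h
    · exact Or.inl h
    · rcases h₂ e with h' | h'
      · exact Or.inl (h.trans h')
      · exact Or.inr (h.trans h')
  le_antisymm X Y h₁ h₂ := by
    ext e
    rcases h₁ e with h | h
    · rcases h₂ e with h' | h'
      · rw [h, h']
      · exact h'.symm
    · exact h

/-- The corank of a covector `X`: the greatest length of a chain `X = X₀ < X₁ < ⋯ < X_k` of
covectors. (The face lattice is graded, so this is the rank of `L` minus the rank of `X`.) -/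
noncomputable def corank {E : Type*} (L : OrientedMatroid E) (X : L.Covector) : ℕ∞ :=
  Order.coheight X

/-- The closed face of `X`: the set of all covectors below `X`. -/
def face {E : Type*} (L : OrientedMatroid E) (X : L.Covector) : Set L.Covector :=
  {Y | Y ≤ X}

/-- A tope (region): a maximal covector. -/
def Tope {E : Type*} (L : OrientedMatroid E) : Type _ :=
  {T : L.Covector // IsMax T}

/-- The adjacency graph on the topes: two distinct topes are adjacent when their closed
faces intersect in a closed face of corank one. -/
def topeGraph {E : Type*} (L : OrientedMatroid E) : SimpleGraph L.Tope where
  Adj S T := S ≠ T ∧ ∃ X : L.Covector, L.corank X = 1 ∧ L.face S.1 ∩ L.face T.1 = L.face X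
  symm := ⟨fun S T h => by
    obtain ⟨hne, X, hX, hST⟩ := h
    exact ⟨hne.symm, X, hX, by rw [Set.inter_comm]; exact hST⟩⟩
  loopless := ⟨fun _ h => h.1 rfl⟩

/-- A path (gallery) from `Q` to `R`: a sequence of topes from `Q` to `R`, consecutive ones being
adjacent; its length is one less than the number of its entries. -/
abbrev Gallery {E : Type*} (L : OrientedMatroid E) (Q R : L.Tope) : Type _ :=
  L.topeGraph.Walk Q R

/-- A polygon: a cycle in the adjacency graph which consists of all the topes whose closed face
contains a given closed face of corank two. -/
def IsPolygon {E : Type*} (L : OrientedMatroid E) {Q : L.Tope} (c : L.Gallery Q Q) : Prop :=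
  c.IsCycle ∧ ∃ X : L.Covector, L.corank X = 2 ∧
    ∀ T : L.Tope, T ∈ c.support ↔ L.face X ⊆ L.face T.1

/-- `γ'` arises from `γ` by a braid move: a consecutive piece `p` is replaced by a piece `p'` of
the same length and with the same ends, such that going along `p` and back along `p'` is a
polygon. -/
def BraidMove {E : Type*} (L : OrientedMatroid E) {Q R : L.Tope} (γ γ' : L.Gallery Q R) : Prop :=
  ∃ (S T : L.Tope) (a : L.Gallery Q S) (p p' : L.Gallery S T) (b : L.Gallery T R),
    p.length = p'.length ∧ L.IsPolygon (p.append p'.reverse) ∧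
    γ = a.append (p.append b) ∧ γ' = a.append (p'.append b)

/-- `γ'` arises from `γ` by a nil move: a consecutive piece `S, T, S` is replaced by `S`. -/
def NilMove {E : Type*} (L : OrientedMatroid E) {Q R : L.Tope} (γ γ' : L.Gallery Q R) : Prop :=
  ∃ (S T : L.Tope) (h : L.topeGraph.Adj S T) (a : L.Gallery Q S) (b : L.Gallery S R),
    γ = a.append (.cons h (.cons h.symm b)) ∧ γ' = a.append b

/-- A gallery is reduced if it has minimal length among all galleries with the same ends. -/
def IsReduced {E : Type*} (L : OrientedMatroid E) {Q R : L.Tope} (ρ : L.Gallery Q R) : Prop :=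
  ∀ γ : L.Gallery Q R, ρ.length ≤ γ.length

/-- Path convexity: every gallery can be transformed into every reduced gallery with the same ends
by a finite sequence of braid moves and nil moves. -/
def PathConvex {E : Type*} (L : OrientedMatroid E) : Prop :=
  ∀ (Q R : L.Tope) (γ ρ : L.Gallery Q R), L.IsReduced ρ →
    Relation.ReflTransGen (fun α β : L.Gallery Q R => L.BraidMove α β ∨ L.NilMove α β) γ ρ

end OrientedMatroid

/-! Call a parallel class of elements a wall. Adjacent topes are separated by exactly one wall, and
two distinct topes are always separated by the wall of some facet of the first
(`exists_facet_separating`, by covector elimination). Hence a gallery is reduced exactly when its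
length is the number of walls separating its ends (`isReduced_iff`).

Induct on the gallery, its tail being movable to every reduced gallery with the same ends as the
tail. If the first wall does not separate the ends, a nil move finishes. Otherwise the first step
followed by a reduced tail is reduced, and it remains to join two reduced galleries p and q from Q
to R (`moves_of_reduced`), by induction on the number of separating walls. If the first step of q
avoids the last wall of p, some reduced gallery begins like q and ends like p, and two shorter
instances suffice.

Otherwise both steps cross the same wall, through facets F and X. In the contraction at that wall F
and X are topes; if they differ, some facet G of F separates them. Every wall through G then
separates Q from R, so the tope opposite Q at G lies on a reduced gallery from Q to R. The topes
above G form a polygon (`IsColine.isPolygon`); going around its other side avoids the last wall of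
p, and a braid move exchanges the two sides. -/

namespace OrientedMatroid

variable {E : Type*}

/-! ### Sign vectors and the face order -/

/-- The face order on sign vectors: `Y` agrees with `X` wherever `X` is nonzero. -/
def SignLE (X Y : E → SignType) : Prop := ∀ e, X e = 0 ∨ X e = Y e

theorem SignLE.refl (X : E → SignType) : SignLE X X := fun _ => Or.inr rfl

theorem SignLE.trans {X Y Z : E → SignType} (h : SignLE X Y) (h' : SignLE Y Z) : SignLE X Z := by
  intro e
  rcases h e with h | h
  · exact Or.inl h
  · rw [h]; exact h' e

theorem SignLE.antisymm {X Y : E → SignType} (h : SignLE X Y) (h' : SignLE Y X) : X = Y := by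
  funext e
  rcases h e with h | h
  · rcases h' e with h' | h'
    · rw [h, h']
    · exact h'.symm
  · exact h

theorem SignLE.eq_of_ne {X Y : E → SignType} (h : SignLE X Y) {e : E} (he : X e ≠ 0) :
    Y e = X e := ((h e).resolve_left he).symm

theorem SignLE.eq_zero {X Y : E → SignType} (h : SignLE X Y) {e : E} (he : Y e = 0) :
    X e = 0 := by
  rcases h e with h | h
  · exact h
  · rw [h, he]

theorem SignLE.exists_zero {X Y : E → SignType} (h : SignLE X Y) (hne : X ≠ Y) :
    ∃ e, X e = 0 ∧ Y e ≠ 0 := by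
  by_contra! hc
  refine hne (funext fun e => ?_)
  rcases h e with h | h
  · rw [h, hc e h]
  · exact h

theorem signLE_comp (X Y : E → SignType) : SignLE X (signComp X Y) := by
  intro e
  by_cases h : X e = 0
  · exact Or.inl h
  · exact Or.inr (by simp [signComp, h])

theorem signComp_of_zero {X : E → SignType} (Y : E → SignType) {e : E} (h : X e = 0) :
    signComp X Y e = Y e := by simp [signComp, h]

theorem signComp_of_ne {X : E → SignType} (Y : E → SignType) {e : E} (h : X e ≠ 0) :
    signComp X Y e = X e := by simp [signComp, h]

/-- Above `G`, the map sending `Y` to `signComp G (-Y)` is reflection in `G`: it fixes the support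
of `G` and negates the rest. It is used throughout to produce opposite topes and to carry facets to
facets. -/
theorem signComp_neg_comp_neg {G Y : E → SignType} (h : SignLE G Y) :
    signComp G (-(signComp G (-Y))) = Y := by
  funext e
  by_cases he : G e = 0
  · simp [signComp, he]
  · simp [signComp, he, h.eq_of_ne he]

theorem signComp_neg_mono {G Y W : E → SignType} (h : SignLE Y W) :
    SignLE (signComp G (-Y)) (signComp G (-W)) := by
  intro e
  by_cases he : G e = 0
  · rw [signComp_of_zero _ he, signComp_of_zero _ he]
    rcases h e with h | h
    · left; simp [h]
    · right; simp [h]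
  · right; rw [signComp_of_ne _ he, signComp_of_ne _ he]

theorem _root_.SignType.eq_neg_of_ne {a b : SignType} (ha : a ≠ 0) (hb : b ≠ 0) (h : a ≠ b) :
    a = -b := by
  revert a b; decide

theorem _root_.SignType.ne_neg_self {a : SignType} (ha : a ≠ 0) : a ≠ -a := by
  revert a; decide

/-! ### Topes and their facets -/

/-- A maximal element of the set of covectors, as a sign vector. -/
def IsTope (L : OrientedMatroid E) (T : E → SignType) : Prop :=
  T ∈ L.covectors ∧ ∀ Y ∈ L.covectors, SignLE T Y → Y = T

/-- `X` is covered by `Q` in the face order. -/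
def Facet (L : OrientedMatroid E) (X Q : E → SignType) : Prop :=
  X ∈ L.covectors ∧ SignLE X Q ∧ X ≠ Q ∧
    ∀ Y ∈ L.covectors, SignLE X Y → SignLE Y Q → Y = X ∨ Y = Q

variable {L : OrientedMatroid E}

theorem comp_neg_mem {X Y : E → SignType} (hX : X ∈ L.covectors) (hY : Y ∈ L.covectors) :
    signComp X (-Y) ∈ L.covectors := L.comp_mem _ hX _ (L.neg_mem _ hY)

/-- Composing `T` with `Y` could only add signs at zeros of `T`, against maximality. So all topes
vanish exactly at the loops. -/
theorem IsTope.eq_zero {T Y : E → SignType} (hT : L.IsTope T) (hY : Y ∈ L.covectors) {e : E}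
    (he : T e = 0) : Y e = 0 := by
  have h := hT.2 _ (L.comp_mem _ hT.1 _ hY) (signLE_comp _ _)
  rw [← signComp_of_zero Y he, h, he]

theorem isTope_of_eq_zero {T S : E → SignType} (hT : L.IsTope T) (hS : S ∈ L.covectors)
    (h : ∀ e, S e = 0 → T e = 0) : L.IsTope S := by
  refine ⟨hS, fun Y hY hle => (hle.antisymm fun e => ?_).symm⟩
  by_cases he : S e = 0
  · exact Or.inl (hT.eq_zero hY (h e he))
  · exact Or.inr (hle.eq_of_ne he)

theorem IsTope.comp_neg {X Q : E → SignType} (hX : X ∈ L.covectors) (hQ : L.IsTope Q) :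
    L.IsTope (signComp X (-Q)) := by
  refine isTope_of_eq_zero hQ (comp_neg_mem hX hQ.1) fun e he => ?_
  by_cases h : X e = 0
  · rw [signComp_of_zero _ h] at he
    simpa using he
  · rw [signComp_of_ne _ h] at he
    exact absurd he h

theorem IsTope.ne_zero {Q R : E → SignType} (hQ : L.IsTope Q) (hR : L.IsTope R) {e : E}
    (h : Q e ≠ 0) : R e ≠ 0 := fun h' => h (hR.eq_zero hQ.1 h')

theorem IsTope.ne_zero_of_ne {Q R : E → SignType} (hQ : L.IsTope Q) (hR : L.IsTope R) {e : E}
    (h : Q e ≠ R e) : Q e ≠ 0 := fun h' => h (by rw [h', hQ.eq_zero hR.1 h'])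

theorem IsTope.ne_zero_of_mem {Q Y : E → SignType} (hQ : L.IsTope Q) (hY : Y ∈ L.covectors) {e : E}
    (h : Y e ≠ 0) : Q e ≠ 0 := fun h' => h (hQ.eq_zero hY h')

/-- Eliminating inside a fixed upper set shrinks the separation set. -/
theorem exists_elim {Q Y : E → SignType} (hQ : Q ∈ L.covectors) (hY : Y ∈ L.covectors)
    {e : E} (he : e ∈ signSep Q Y) :
    ∃ Z ∈ L.covectors, Z e = 0 ∧ (∀ f, f ∉ signSep Q Y → Z f = signComp Q Y f) ∧
      signSep Q Z ⊂ signSep Q Y := by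
  obtain ⟨Z, hZ, hZe, hZf⟩ := L.elim Q hQ Y hY e he
  refine ⟨Z, hZ, hZe, hZf, ?_, fun hsub => ?_⟩
  · intro f hf
    by_contra hfY
    have h := hZf f hfY
    rw [signComp_of_ne _ hf.1] at h
    have h2 := hf.2
    rw [h] at h2
    exact SignType.ne_neg_self hf.1 h2
  · have h := hsub he
    have h2 := h.2
    rw [hZe, neg_zero] at h2
    exact h.1 h2

theorem signLE_of_signSep_eq_empty {Q Y : E → SignType} (hQ : L.IsTope Q) (hY : Y ∈ L.covectors)
    (h : signSep Q Y = ∅) : SignLE Y Q := by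
  intro e
  by_cases h0 : Y e = 0
  · exact Or.inl h0
  · right
    by_contra hne
    have hq : Q e ≠ 0 := hQ.ne_zero_of_mem hY h0
    have : e ∈ signSep Q Y := ⟨hq, SignType.eq_neg_of_ne hq h0 (Ne.symm hne)⟩
    rw [h] at this
    exact this

/-- A facet of a tope lies below exactly two topes and no further covectors. -/
theorem Facet.eq_or [Finite E] {X Q Y : E → SignType} (hQ : L.IsTope Q) (hX : L.Facet X Q)
    (hY : Y ∈ L.covectors) (hle : SignLE X Y) : Y = X ∨ Y = Q ∨ Y = signComp X (-Q) := by
  -- Eliminating an element of the separation set of `Q` and `Y` gives `Z` above `X` with a smaller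
  -- one. Once that is empty, `Z` lies between `X` and `Q` with a new zero, so `Z = X`, which forces
  -- the whole wall of `X` into the original set.
  have key : ∀ n, ∀ Y ∈ L.covectors, SignLE X Y → (signSep Q Y).ncard = n →
      (signSep Q Y).Nonempty → ∀ e, X e = 0 → Q e ≠ 0 → e ∈ signSep Q Y := by
    intro n
    induction n using Nat.strong_induction_on with
    | _ n ih =>
      intro Y hY hle hn ⟨e, he⟩ f hXf hQf
      obtain ⟨Z, hZ, hZe, hZf, hss⟩ := exists_elim hQ.1 hY he
      have hXZ : SignLE X Z := by
        intro g
        by_cases hg : X g = 0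
        · exact Or.inl hg
        · right
          have h1 := hX.2.1.eq_of_ne hg
          have h2 := hle.eq_of_ne hg
          rw [hZf g, signComp_of_ne, h1]
          · rwa [h1]
          · intro hs
            have h3 := hs.2
            rw [h1, h2] at h3
            exact SignType.ne_neg_self hg h3
      rcases (signSep Q Z).eq_empty_or_nonempty with h0 | hne
      · have hZQ : SignLE Z Q := signLE_of_signSep_eq_empty hQ hZ h0
        rcases hX.2.2.2 Z hZ hXZ hZQ with rfl | rfl
        · by_contra hfn
          have h4 := hZf f hfn
          rw [signComp_of_ne _ hQf, hXf] at h4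
          exact hQf h4.symm
        · exact absurd hZe he.1
      · exact hss.1 (ih _ (hn ▸ Set.ncard_lt_ncard hss) Z hZ hXZ rfl hne f hXf hQf)
  rcases (signSep Q Y).eq_empty_or_nonempty with h0 | hne
  · have := hX.2.2.2 Y hY hle (signLE_of_signSep_eq_empty hQ hY h0)
    tauto
  · right; right
    funext e
    by_cases he : X e = 0
    · rw [signComp_of_zero _ he]
      by_cases hq : Q e = 0
      · rw [hQ.eq_zero hY hq, Pi.neg_apply, hq, neg_zero]
      · have := (key _ Y hY hle rfl hne e he hq).2
        rw [Pi.neg_apply, this, neg_neg]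
    · rw [signComp_of_ne _ he, hle.eq_of_ne he]

theorem exists_facet_of_lt [Finite E] {Q : E → SignType} {Y : E → SignType} (hY : Y ∈ L.covectors)
    (hle : SignLE Y Q) (hne : Y ≠ Q) : ∃ X, L.Facet X Q ∧ SignLE Y X := by
  let s : Set (E → SignType) := {X | X ∈ L.covectors ∧ SignLE Y X ∧ SignLE X Q ∧ X ≠ Q}
  obtain ⟨X, ⟨hX, hYX, hXQ, hXne⟩, hmin⟩ :=
    Set.exists_min_image s (fun X => {e | X e = 0}.ncard) (Set.toFinite s)
      ⟨Y, hY, SignLE.refl Y, hle, hne⟩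
  refine ⟨X, ⟨hX, hXQ, hXne, fun W hW hXW hWQ => ?_⟩, hYX⟩
  by_contra! hc
  have hm := hmin W ⟨hW, hYX.trans hXW, hWQ, hc.2⟩
  have hss : {e | W e = 0} ⊂ {e | X e = 0} := by
    refine ⟨fun e he => hXW.eq_zero he, fun hsub => ?_⟩
    obtain ⟨e, he, he'⟩ := hXW.exists_zero (Ne.symm hc.1)
    exact he' (hsub he)
  exact absurd (Set.ncard_lt_ncard hss) (not_lt.mpr hm)

/-- Distinct topes are separated by a facet of the first one. -/
theorem exists_facet_separating [Finite E] {Q R : E → SignType} (hQ : L.IsTope Q)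
    (hR : L.IsTope R) (hne : Q ≠ R) :
    ∃ X, L.Facet X Q ∧ ∀ e, X e = 0 → Q e = -R e := by
  -- Covectors that differ from `Q` only where `Q` and `R` are opposite. One with fewest separations
  -- from `Q` must be a face of `Q`, and any facet above it inherits the property.
  let s : Set (E → SignType) :=
    {Y | Y ∈ L.covectors ∧ Y ≠ Q ∧ ∀ e, Y e ≠ Q e → Q e = -R e}
  have hRs : R ∈ s := ⟨hR.1, hne.symm, fun e he => by
    have h0 := hR.ne_zero_of_ne hQ he
    exact SignType.eq_neg_of_ne (hR.ne_zero hQ h0) h0 (Ne.symm he)⟩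
  obtain ⟨Y, ⟨hY, hYne, hYs⟩, hmin⟩ :=
    Set.exists_min_image s (fun Y => (signSep Q Y).ncard) (Set.toFinite s) ⟨R, hRs⟩
  have h0 : signSep Q Y = ∅ := by
    by_contra hcon
    obtain ⟨e, he⟩ := Set.nonempty_iff_ne_empty.mpr hcon
    obtain ⟨Z, hZ, hZe, hZf, hss⟩ := exists_elim hQ.1 hY he
    have hZs : Z ∈ s := by
      refine ⟨hZ, fun h => he.1 (by rw [← h, hZe]), fun f hf => ?_⟩
      by_cases hQf : Q f = 0
      · exact absurd (by rw [hQf, hQ.eq_zero hZ hQf]) hf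
      · by_cases hfs : f ∈ signSep Q Y
        · refine hYs f fun h => SignType.ne_neg_self hQf ?_
          have h2 := hfs.2
          rwa [h] at h2
        · exact absurd (by rw [hZf f hfs, signComp_of_ne _ hQf]) hf
    exact absurd (Set.ncard_lt_ncard hss) (not_lt.mpr (hmin Z hZs))
  obtain ⟨X, hX, hYX⟩ := exists_facet_of_lt hY (signLE_of_signSep_eq_empty hQ hY h0) hYne
  refine ⟨X, hX, fun e he => ?_⟩
  by_cases hq : Q e = 0
  · rw [hq, hQ.eq_zero hR.1 hq, neg_zero]
  · exact hYs e fun h => hq (by rw [← h, hYX.eq_zero he])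

/-! ### Contraction and parallel classes -/

/-- The contraction of `L` at `e`: the covectors vanishing at `e`. -/
def contract (L : OrientedMatroid E) (e : E) : OrientedMatroid E where
  covectors := {X | X ∈ L.covectors ∧ X e = 0}
  zero_mem := ⟨L.zero_mem, rfl⟩
  neg_mem X hX := ⟨L.neg_mem X hX.1, by simp [hX.2]⟩
  comp_mem X hX Y hY := ⟨L.comp_mem X hX.1 Y hY.1, by rw [signComp_of_zero _ hX.2, hY.2]⟩
  elim X hX Y hY f hf := by
    obtain ⟨Z, hZ, hZf, hZg⟩ := L.elim X hX.1 Y hY.1 f hf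
    refine ⟨Z, ⟨hZ, ?_⟩, hZf, hZg⟩
    rw [hZg e fun h => h.1 hX.2, signComp_of_zero _ hX.2, hY.2]

/-- Of the three covectors above `X`, only `X` vanishes at `e`. This lets the facet lemmas be reused
one dimension lower. -/
theorem Facet.isTope_contract [Finite E] {X Q : E → SignType} (hQ : L.IsTope Q)
    (hX : L.Facet X Q) {e : E} (he : X e = 0) (hQe : Q e ≠ 0) : (L.contract e).IsTope X := by
  refine ⟨⟨hX.1, he⟩, fun Y hY hle => ?_⟩
  rcases hX.eq_or hQ hY.1 hle with h | h | h
  · exact h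
  · exact absurd (h ▸ hY.2) hQe
  · have h2 := hY.2
    rw [h, signComp_of_zero _ he] at h2
    exact absurd (by simpa using h2) hQe

theorem facet_contract_iff {G F : E → SignType} {e : E} (he : F e = 0) :
    (L.contract e).Facet G F ↔ L.Facet G F := by
  constructor
  · rintro ⟨hG, hle, hne, h⟩
    exact ⟨hG.1, hle, hne, fun Y hY h1 h2 => h Y ⟨hY, h2.eq_zero he⟩ h1 h2⟩
  · rintro ⟨hG, hle, hne, h⟩
    exact ⟨⟨hG, hle.eq_zero he⟩, hle, hne, fun Y hY h1 h2 => h Y hY.1 h1 h2⟩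

/-- Reflection at a common face `G` preserves facets. -/
theorem Facet.comp_neg {G Y T : E → SignType} (hG : G ∈ L.covectors)
    (hY : L.Facet Y T) (hGY : SignLE G Y) :
    L.Facet (signComp G (-Y)) (signComp G (-T)) := by
  have hGT := hGY.trans hY.2.1
  refine ⟨comp_neg_mem hG hY.1, signComp_neg_mono hY.2.1, fun h => hY.2.2.1 ?_, fun W hW h1 h2 => ?_⟩
  · rw [← signComp_neg_comp_neg hGY, h, signComp_neg_comp_neg hGT]
  · have hGW : SignLE G W := (signLE_comp G _).trans h1
    have h3 := signComp_neg_mono (G := G) h1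
    have h4 := signComp_neg_mono (G := G) h2
    rw [signComp_neg_comp_neg hGY] at h3
    rw [signComp_neg_comp_neg hGT] at h4
    rcases hY.2.2.2 _ (comp_neg_mem hG hW) h3 h4 with h | h
    · left; rw [← h, signComp_neg_comp_neg hGW]
    · right; rw [← h, signComp_neg_comp_neg hGW]

/-- The elements at which exactly the same covectors vanish as at `e`. -/
def parallelClass (L : OrientedMatroid E) (e : E) : Set E :=
  {f | ∀ X ∈ L.covectors, X e = 0 ↔ X f = 0}

theorem parallelClass_eq_iff {e f : E} :
    L.parallelClass e = L.parallelClass f ↔ ∀ X ∈ L.covectors, X e = 0 ↔ X f = 0 := by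
  constructor
  · intro h
    have : f ∈ L.parallelClass f := fun _ _ => Iff.rfl
    rw [← h] at this
    exact this
  · intro h
    ext g
    exact forall₂_congr fun X hX => by rw [h X hX]

/-- Eliminating `e` between `Q` and `R` gives a covector vanishing at `e`, hence at `f`; it would
keep a nonzero common sign at `f`. -/
theorem IsTope.ne_of_parallelClass_eq {Q R : E → SignType} (hQ : L.IsTope Q) (hR : L.IsTope R)
    {e f : E} (h : L.parallelClass e = L.parallelClass f) (he : Q e ≠ R e) : Q f ≠ R f := by
  rw [parallelClass_eq_iff] at h
  have h0 := hQ.ne_zero_of_ne hR he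
  have h0' := hQ.ne_zero hR h0
  obtain ⟨Z, hZ, hZe, hZf⟩ := L.elim Q hQ.1 R hR.1 e ⟨h0, SignType.eq_neg_of_ne h0 h0' he⟩
  intro hQR
  have hf0 : Q f ≠ 0 := fun h1 => h0 ((h Q hQ.1).2 h1)
  have := hZf f fun hs => SignType.ne_neg_self hf0 (by have := hs.2; rwa [← hQR] at this)
  rw [signComp_of_ne _ hf0, (h Z hZ).1 hZe] at this
  exact hf0 this.symm

/-- The wall of a facet is one parallel class: `X` is maximal among the covectors vanishing at `e`,
so composing it with such a covector adds no sign at any other zero of `X`. -/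
theorem Facet.eq_zero_iff_parallelClass [Finite E] {X Q : E → SignType} (hQ : L.IsTope Q)
    (hX : L.Facet X Q) {e : E} (he : X e = 0) (hQe : Q e ≠ 0) (f : E) :
    (X f = 0 ∧ Q f ≠ 0) ↔ L.parallelClass f = L.parallelClass e := by
  have key : ∀ {e f : E}, X e = 0 → Q e ≠ 0 → X f = 0 → ∀ Y ∈ L.covectors, Y e = 0 → Y f = 0 := by
    intro e f he hQe hf Y hY hYe
    have h1 := (hX.isTope_contract hQ he hQe).2 (signComp X Y)
      ⟨L.comp_mem _ hX.1 _ hY, by rw [signComp_of_zero _ he, hYe]⟩ (signLE_comp _ _)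
    rw [← signComp_of_zero Y hf, h1, hf]
  rw [parallelClass_eq_iff]
  constructor
  · rintro ⟨hf, hQf⟩ Y hY
    exact ⟨key hf hQf he Y hY, key he hQe hf Y hY⟩
  · intro h
    exact ⟨(h X hX.1).2 he, fun h' => hQe ((h Q hQ.1).1 h')⟩

theorem Facet.eq_of_common_zero [Finite E] {X Y Q : E → SignType} (hQ : L.IsTope Q)
    (hX : L.Facet X Q) (hY : L.Facet Y Q) {e : E} (he : X e = 0) (he' : Y e = 0) (hQe : Q e ≠ 0) :
    X = Y := by
  have h : ∀ f, Q f ≠ 0 → (X f = 0 ↔ Y f = 0) := fun f hf => by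
    have h1 := hX.eq_zero_iff_parallelClass hQ he hQe f
    have h2 := hY.eq_zero_iff_parallelClass hQ he' hQe f
    tauto
  funext f
  by_cases hf : Q f = 0
  · rw [hQ.eq_zero hX.1 hf, hQ.eq_zero hY.1 hf]
  · by_cases h0 : X f = 0
    · rw [h0, (h f hf).1 h0]
    · rw [← hX.2.1.eq_of_ne h0, hY.2.1.eq_of_ne (fun h' => h0 ((h f hf).2 h'))]

theorem Facet.le_of_le_of_le_comp_neg {G X Q : E → SignType} (hX : L.Facet X Q) (hGQ : SignLE G Q)
    (hG : SignLE G (signComp X (-Q))) : SignLE G X := by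
  intro e
  by_cases hG0 : G e = 0
  · exact Or.inl hG0
  · right
    by_cases hX0 : X e = 0
    · have h1 := hG.eq_of_ne hG0
      rw [signComp_of_zero _ hX0, Pi.neg_apply, hGQ.eq_of_ne hG0] at h1
      exact absurd h1.symm (SignType.ne_neg_self hG0)
    · rw [← hX.2.1.eq_of_ne hX0, hGQ.eq_of_ne hG0]

/-! ### Colines -/

/-- A covector of corank two, in terms of sign vectors. -/
structure IsColine (L : OrientedMatroid E) (G : E → SignType) : Prop where
  mem : G ∈ L.covectors
  isTope_of_lt_of_lt : ∀ Y ∈ L.covectors, ∀ W ∈ L.covectors, SignLE G Y → G ≠ Y → SignLE Y W →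
    Y ≠ W → L.IsTope W
  not_facet : ∀ S, L.IsTope S → ¬ L.Facet G S

theorem Facet.isColine [Finite E] {G F Q : E → SignType} (hQ : L.IsTope Q) (hF : L.Facet F Q)
    (hG : L.Facet G F) : L.IsColine G := by
  obtain ⟨e, he, hQe⟩ := hF.2.1.exists_zero hF.2.2.1
  have hGe := hG.2.1.eq_zero he
  have htope := hF.isTope_contract hQ he hQe
  have hGF := (facet_contract_iff he).2 hG
  have hN : L.Facet (signComp G (-F)) (signComp G (-Q)) := hF.comp_neg hG.1 hG.2.1
  have hNT : L.IsTope (signComp G (-Q)) := hQ.comp_neg hG.1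
  -- the only covectors above `G` vanishing at `e`
  have hcases : ∀ Z ∈ L.covectors, Z e = 0 → SignLE G Z → Z ≠ G →
      ∃ S, L.IsTope S ∧ L.Facet Z S ∧ S e ≠ 0 := by
    intro Z hZ hZe hle hne
    rcases hGF.eq_or htope ⟨hZ, hZe⟩ hle with h | h | h
    · exact absurd h hne
    · exact ⟨Q, hQ, h ▸ hF, hQe⟩
    · exact ⟨_, hNT, h ▸ hN, hQ.ne_zero hNT hQe⟩
  refine ⟨hG.1, fun Y hY W hW hGY hGYne hYW hYWne => ?_, fun S hS hGS => ?_⟩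
  · by_cases hYe : Y e = 0
    · obtain ⟨S, hS, hYS, -⟩ := hcases Y hY hYe hGY (Ne.symm hGYne)
      rcases hYS.eq_or hS hW hYW with h | h | h
      · exact absurd h.symm hYWne
      · exact h ▸ hS
      · exact h ▸ hS.comp_neg hY
    · have hGW := hGY.trans hYW
      have hWe := hYW.eq_of_ne hYe
      have hsep : ∀ g, g ∈ signSep W (signComp G (-Y)) → Y g ≠ 0 ∧ G g = 0 := by
        intro g hg
        by_cases hg0 : G g = 0
        · refine ⟨fun h => hg.1 ?_, hg0⟩
          rw [hg.2, signComp_of_zero _ hg0, Pi.neg_apply, h, neg_zero, neg_zero]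
        · have h2 := hg.2
          rw [signComp_of_ne _ hg0, ← hGW.eq_of_ne hg0] at h2
          exact absurd h2 (SignType.ne_neg_self hg.1)
      -- `Z` is strictly above `G` and vanishes at `e`, so it is a facet of a tope `S`. A zero of
      -- `W` outside the zeros of `S` would be a zero of `Z`, hence parallel to `e`, where `W` is
      -- nonzero.
      obtain ⟨Z, hZ, hZe, hZf⟩ := L.elim W hW _ (comp_neg_mem hG.1 hY) e
        ⟨by rwa [hWe], by rw [signComp_of_zero _ hGe, Pi.neg_apply, neg_neg, hWe]⟩
      obtain ⟨f, hYf, hWf⟩ := hYW.exists_zero hYWne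
      have hGZ : SignLE G Z := by
        intro g
        by_cases hg0 : G g = 0
        · exact Or.inl hg0
        · right
          rw [hZf g (fun h => hg0 (hsep g h).2), signComp_of_ne, hGW.eq_of_ne hg0]
          rwa [hGW.eq_of_ne hg0]
      have hZne : Z ≠ G := by
        intro h
        have h1 := hZf f (fun h => (hsep f h).1 hYf)
        rw [signComp_of_ne _ hWf, h, hGY.eq_zero hYf] at h1
        exact hWf h1.symm
      obtain ⟨S, hS, hZS, hSe⟩ := hcases Z hZ hZe hGZ hZne
      refine isTope_of_eq_zero hS hW fun g hg => ?_
      by_contra hSg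
      have hYg := hYW.eq_zero hg
      have hZg : Z g = 0 := by
        rw [hZf g (fun h => (hsep g h).1 hYg), signComp_of_zero _ hg,
          signComp_of_zero _ (hGY.eq_zero hYg), Pi.neg_apply, hYg, neg_zero]
      have hcl := (hZS.eq_zero_iff_parallelClass hS hZe hSe g).1 ⟨hZg, hSg⟩
      rw [parallelClass_eq_iff] at hcl
      exact hYe (hWe ▸ (hcl W hW).1 hg)
  · rcases hGS.eq_or hS hF.1 hG.2.1 with h | h | h
    · exact hG.2.2.1 h.symm
    · exact hQe (hS.eq_zero hQ.1 (h ▸ he))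
    · exact hQe ((hS.comp_neg hG.1).eq_zero hQ.1 (h ▸ he))

theorem IsColine.facet [Finite E] {G F S : E → SignType} (hG : L.IsColine G) (hS : L.IsTope S)
    (hF : L.Facet F S) (hle : SignLE G F) : L.Facet G F := by
  refine ⟨hG.mem, hle, fun h => hG.not_facet S hS (h ▸ hF), fun Y hY h1 h2 => ?_⟩
  by_contra! hc
  have := hG.isTope_of_lt_of_lt Y hY F hF.1 h1 (Ne.symm hc.1) h2 hc.2
  exact hF.2.2.1 (this.2 S hS.1 hF.2.1).symm

/-- A tope has at most two facets above a given coline. -/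
theorem IsColine.facet_eq_or [Finite E] {G S F₁ F₂ F₃ : E → SignType} (hG : L.IsColine G)
    (hS : L.IsTope S) (h₁ : L.Facet F₁ S) (h₂ : L.Facet F₂ S) (h₃ : L.Facet F₃ S)
    (hG₁ : SignLE G F₁) (hG₂ : SignLE G F₂) (hG₃ : SignLE G F₃) (h₁₂ : F₁ ≠ F₂) :
    F₃ = F₁ ∨ F₃ = F₂ := by
  by_contra! hc
  obtain ⟨h₃₁, h₃₂⟩ := hc
  have aux : ∀ {X Y : E → SignType}, L.Facet X S → L.Facet Y S → X ≠ Y → ∀ {g}, X g = 0 →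
      S g ≠ 0 → Y g = S g := by
    intro X Y hX hY hne g hg hSg
    refine (hY.2.1.eq_of_ne fun h => hne (hX.eq_of_common_zero hS hY hg h hSg)).symm
  obtain ⟨f, hf, hSf⟩ := h₃.2.1.exists_zero h₃.2.2.1
  obtain ⟨g₁, hg₁, hSg₁⟩ := h₁.2.1.exists_zero h₁.2.2.1
  obtain ⟨g₂, hg₂, hSg₂⟩ := h₂.2.1.exists_zero h₂.2.2.1
  have hF₁f := aux h₃ h₁ h₃₁ hf hSf
  have hF₂f := aux h₃ h₂ h₃₂ hf hSf
  have hGf := hG₃.eq_zero hf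
  have hGg₁ := hG₁.eq_zero hg₁
  have hGg₂ := hG₂.eq_zero hg₂
  -- In the contraction at `f` the only covectors above `G` are `G`, `F₃` and its reflection. But
  -- `Z` disagrees with `S` at `g₁` and agrees with it at `g₂`, which none of the three does.
  obtain ⟨Z, hZ, hZf, hZg⟩ := L.elim F₁ h₁.1 _ (comp_neg_mem hG.mem h₂.1) f
    ⟨by rwa [hF₁f], by rw [signComp_of_zero _ hGf, Pi.neg_apply, neg_neg, hF₁f, hF₂f]⟩
  have hGZ : SignLE G Z := by
    intro g
    by_cases hg0 : G g = 0
    · exact Or.inl hg0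
    · right
      have h1 := hG₁.eq_of_ne hg0
      rw [hZg g, signComp_of_ne, h1]
      · rwa [h1]
      · intro hs
        have h2 := hs.2
        rw [h1, signComp_of_ne _ hg0] at h2
        exact SignType.ne_neg_self hg0 h2
  have hZ₁ : Z g₁ = -S g₁ := by
    rw [hZg g₁ (fun h => h.1 hg₁), signComp_of_zero _ hg₁, signComp_of_zero _ hGg₁, Pi.neg_apply,
      aux h₁ h₂ h₁₂ hg₁ hSg₁]
  have hF₁g₂ := aux h₂ h₁ h₁₂.symm hg₂ hSg₂
  have hZ₂ : Z g₂ = S g₂ := by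
    rw [hZg g₂, signComp_of_ne, hF₁g₂]
    · rwa [hF₁g₂]
    · intro h
      have h2 := h.2
      rw [signComp_of_zero _ hGg₂, Pi.neg_apply, hg₂, neg_zero, neg_zero] at h2
      exact h.1 h2
  rcases ((facet_contract_iff hf).2 (hG.facet hS h₃ hG₃)).eq_or (h₃.isTope_contract hS hf hSf)
    ⟨hZ, hZf⟩ hGZ with h | h | h
  · rw [h, hGg₂] at hZ₂
    exact hSg₂ hZ₂.symm
  · rw [h, aux h₁ h₃ h₃₁.symm hg₁ hSg₁] at hZ₁
    exact SignType.ne_neg_self hSg₁ hZ₁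
  · rw [h, signComp_of_zero _ hGg₂, Pi.neg_apply, aux h₂ h₃ h₃₂.symm hg₂ hSg₂] at hZ₂
    exact SignType.ne_neg_self hSg₂ hZ₂.symm

/-- A tope has a second facet above a given coline. -/
theorem IsColine.exists_facet_ne [Finite E] {G F Q : E → SignType} (hG : L.IsColine G)
    (hQ : L.IsTope Q) (hF : L.Facet F Q) (hGF : SignLE G F) :
    ∃ F', L.Facet F' Q ∧ SignLE G F' ∧ F' ≠ F := by
  have hGQ := hGF.trans hF.2.1
  -- This tope agrees with `Q` on the support of `G` and on the wall of `F`, so a facet separating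
  -- `Q` from it lies above `G` and is not `F`.
  have hR : L.IsTope (signComp G (-(signComp F (-Q)))) := (hQ.comp_neg hF.1).comp_neg hG.mem
  obtain ⟨g, hGg, hFg⟩ := hGF.exists_zero fun h => hG.not_facet Q hQ (h ▸ hF)
  have hQg := hF.2.1.eq_of_ne hFg
  obtain ⟨F', hF', hsep⟩ := exists_facet_separating hQ hR (fun h => by
    have h1 := congrFun h g
    rw [signComp_of_zero _ hGg, Pi.neg_apply, signComp_of_ne _ hFg, hQg] at h1
    exact SignType.ne_neg_self hFg h1)
  refine ⟨F', hF', fun e => ?_, fun h => ?_⟩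
  · by_cases hGe : G e = 0
    · exact Or.inl hGe
    · right
      have hne : F' e ≠ 0 := by
        intro h0
        have h1 := hsep e h0
        rw [signComp_of_ne _ hGe, hGQ.eq_of_ne hGe] at h1
        exact SignType.ne_neg_self hGe h1
      rw [← hF'.2.1.eq_of_ne hne, hGQ.eq_of_ne hGe]
  · obtain ⟨f, hf, hQf⟩ := hF.2.1.exists_zero hF.2.2.1
    have h1 := hsep f (by rw [h, hf])
    rw [signComp_of_zero _ (hGF.eq_zero hf), Pi.neg_apply, signComp_of_zero _ hf, Pi.neg_apply,
      neg_neg] at h1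
    exact SignType.ne_neg_self hQf h1

/-! ### Corank and adjacency in terms of facets -/

instance [Finite E] : Finite L.Covector :=
  Finite.of_injective Covector.val fun _ _ => Covector.ext

/-- The sign vector of a tope. -/
def Tope.sign (T : L.Tope) : E → SignType := T.1.val

theorem Tope.isTope (T : L.Tope) : L.IsTope T.sign := by
  refine ⟨T.1.mem, fun Y hY hle => ?_⟩
  have h : (⟨Y, hY⟩ : L.Covector) ≤ T.1 := T.2 (b := ⟨Y, hY⟩) hle
  exact SignLE.antisymm (X := Y) h hle

theorem Tope.sign_injective : Function.Injective (Tope.sign (L := L)) :=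
  fun _ _ h => Subtype.ext (Covector.ext h)

theorem IsTope.isMax {X : L.Covector} (h : L.IsTope X.val) : IsMax X := by
  intro Y hY
  have h1 : Y = X := Covector.ext (h.2 Y.val Y.mem hY)
  rw [h1]

/-- The tope with a given sign vector. -/
def IsTope.toTope {T : E → SignType} (h : L.IsTope T) : L.Tope :=
  ⟨⟨T, h.1⟩, IsTope.isMax h⟩

@[simp] theorem IsTope.sign_toTope {T : E → SignType} (h : L.IsTope T) : h.toTope.sign = T := rfl

theorem isTope_of_isMax {X : L.Covector} (h : IsMax X) : L.IsTope X.val :=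
  Tope.isTope ⟨X, h⟩

theorem Facet.corank_eq_one [Finite E] {X : L.Covector} {Q : E → SignType} (hQ : L.IsTope Q)
    (hX : L.Facet X.val Q) : L.corank X = 1 := by
  have hmax : ∀ Y > X, Order.coheight Y = 0 := fun Y hY => by
    rw [Order.coheight_eq_zero]
    apply IsTope.isMax
    rcases hX.eq_or hQ Y.mem hY.le with h | h | h
    · exact absurd (Covector.ext h) hY.ne'
    · exact h ▸ hQ
    · exact h ▸ hQ.comp_neg hX.1
  have hlt : X < ⟨Q, hQ.1⟩ :=
    lt_of_le_of_ne hX.2.1 fun h => hX.2.2.1 (congrArg Covector.val h)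
  have hle : Order.coheight X ≤ (1 : ℕ) :=
    Order.coheight_le_coe_iff.2 fun Y hY => by rw [hmax Y hY]; simp
  have := (Order.coheight_eq_coe_add_one_iff (x := X) (n := 0)).2
    ⟨hle.trans_lt (by simp), ⟨_, hlt, hmax _ hlt⟩, fun Y hY => (hmax Y hY).le⟩
  simpa [corank] using this

theorem facet_of_corank_eq_one {X : L.Covector} (hX : L.corank X = 1) {Q : L.Tope}
    (hle : X ≤ Q.1) : L.Facet X.val Q.sign := by
  have h1 := (Order.coheight_eq_coe_add_one_iff (x := X) (n := 0)).1 (by simpa [corank] using hX)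
  refine ⟨X.mem, hle, fun h => ?_, fun Y hY h2 h3 => ?_⟩
  · have hXQ : X = Q.1 := Covector.ext h
    have := Order.coheight_eq_zero.2 (hXQ ▸ Q.2)
    rw [corank, this] at hX
    exact zero_ne_one hX
  · by_contra! hc
    have hlt : X < ⟨Y, hY⟩ := lt_of_le_of_ne h2 fun h => hc.1 (congrArg Covector.val h).symm
    have h4 := h1.2.2 _ hlt
    have h5 := (isTope_of_isMax (Order.coheight_eq_zero.1 (nonpos_iff_eq_zero.1 (by simpa using h4))))
    exact hc.2 (h5.2 _ Q.1.mem h3).symm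

theorem topeGraph_adj_iff [Finite E] {S T : L.Tope} :
    L.topeGraph.Adj S T ↔ ∃ X, L.Facet X S.sign ∧ T.sign = signComp X (-S.sign) := by
  constructor
  · rintro ⟨hne, X, hX, hface⟩
    have hmem : X ∈ L.face S.1 ∩ L.face T.1 := by rw [hface]; exact le_refl X
    have hS := facet_of_corank_eq_one hX (Q := S) hmem.1
    have hT := facet_of_corank_eq_one hX (Q := T) hmem.2
    refine ⟨X.val, hS, ?_⟩
    rcases hS.eq_or S.isTope T.isTope.1 hT.2.1 with h | h | h
    · exact absurd h.symm hT.2.2.1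
    · exact absurd (Tope.sign_injective h).symm hne
    · exact h
  · rintro ⟨X, hX, hT⟩
    obtain ⟨e, he, hSe⟩ := hX.2.1.exists_zero hX.2.2.1
    refine ⟨fun h => ?_, ⟨X, hX.1⟩, Facet.corank_eq_one S.isTope hX, ?_⟩
    · have h1 := congrFun hT e
      rw [← h, signComp_of_zero _ he] at h1
      exact SignType.ne_neg_self hSe h1
    · ext Y
      constructor
      · rintro ⟨h1, h2⟩
        exact hX.le_of_le_of_le_comp_neg (G := Y.val) h1 (hT ▸ h2)
      · intro h
        refine ⟨SignLE.trans (Y := X) h hX.2.1, SignLE.trans (Y := X) (Z := T.sign) h ?_⟩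
        rw [hT]
        exact signLE_comp _ _

theorem IsColine.corank_eq_two [Finite E] {X : L.Covector} {F Q : E → SignType} (hQ : L.IsTope Q)
    (hF : L.Facet F Q) (hG : L.Facet X.val F) (hX : L.IsColine X.val) : L.corank X = 2 := by
  have hle1 : ∀ Y > X, Order.coheight Y ≤ (1 : ℕ) := fun Y hY =>
    Order.coheight_le_coe_iff.2 fun W hW => by
      rw [Order.coheight_eq_zero.2 (IsTope.isMax (hX.isTope_of_lt_of_lt Y.val Y.mem W.val W.mem hY.le
        (fun h => hY.ne (Covector.ext h)) hW.le (fun h => hW.ne (Covector.ext h))))]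
      simp
  have hlt : X < ⟨F, hF.1⟩ := lt_of_le_of_ne hG.2.1 fun h => hG.2.2.1 (congrArg Covector.val h)
  have hle : Order.coheight X ≤ (2 : ℕ) :=
    Order.coheight_le_coe_iff.2 fun Y hY => (hle1 Y hY).trans_lt (by norm_num)
  have := (Order.coheight_eq_coe_add_one_iff (x := X) (n := 1)).2
    ⟨hle.trans_lt (by exact_mod_cast ENat.natCast_lt_top 2),
      ⟨_, hlt, Facet.corank_eq_one (X := ⟨F, hF.1⟩) hQ hF⟩, hle1⟩
  rw [corank, this]
  norm_num

/-! ### Gallery distance as the number of separating walls -/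

/-- The set of parallel classes separating two topes. -/
def sepClasses (S T : L.Tope) : Set (Set E) :=
  L.parallelClass '' {e | S.sign e ≠ T.sign e}

theorem mem_sepClasses {S T : L.Tope} {e : E} :
    L.parallelClass e ∈ sepClasses S T ↔ S.sign e ≠ T.sign e :=
  ⟨fun ⟨_, hf, h⟩ => S.isTope.ne_of_parallelClass_eq T.isTope h hf, fun h => ⟨e, h, rfl⟩⟩

/-- The number of parallel classes separating two topes. -/
noncomputable def sepCard (S T : L.Tope) : ℕ := (sepClasses S T).ncard

theorem sepClasses_comm (S T : L.Tope) : sepClasses S T = sepClasses T S := by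
  simp only [sepClasses, ne_comm]

theorem sepCard_comm (S T : L.Tope) : sepCard S T = sepCard T S := by
  rw [sepCard, sepClasses_comm, ← sepCard]

@[simp] theorem sepCard_self (S : L.Tope) : sepCard S S = 0 := by
  simp [sepCard, sepClasses]

theorem sepClasses_subset_union (S T R : L.Tope) :
    sepClasses S R ⊆ sepClasses S T ∪ sepClasses T R := by
  rintro _ ⟨e, he, rfl⟩
  by_cases h : S.sign e = T.sign e
  · exact Or.inr ⟨e, fun h' => he (h.trans h'), rfl⟩
  · exact Or.inl ⟨e, h, rfl⟩

section

variable [Finite E]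

instance (S T : L.Tope) : Finite (sepClasses S T) :=
  (Set.toFinite {e | S.sign e ≠ T.sign e}).image _

theorem sepCard_eq_zero {S T : L.Tope} : sepCard S T = 0 ↔ S = T := by
  constructor
  · intro h
    rw [sepCard, Set.ncard_eq_zero (Set.toFinite _)] at h
    apply Tope.sign_injective
    funext e
    by_contra hne
    have : L.parallelClass e ∈ sepClasses S T := ⟨e, hne, rfl⟩
    rw [h] at this
    exact this
  · rintro rfl
    simp

theorem sepCard_triangle (S T R : L.Tope) : sepCard S R ≤ sepCard S T + sepCard T R :=
  (Set.ncard_le_ncard (sepClasses_subset_union S T R) (Set.toFinite _)).trans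
    (Set.ncard_union_le _ _)

/-- Equality in the triangle inequality leaves no room for a wall that separates `T` from both ends.
-/
theorem eq_of_sepCard_add {S T R : L.Tope} (h : sepCard S T + sepCard T R = sepCard S R) {e : E}
    (he : S.sign e = R.sign e) : T.sign e = S.sign e := by
  have h1 := Set.eq_of_subset_of_ncard_le (sepClasses_subset_union S T R)
    ((Set.ncard_union_le _ _).trans h.le) (Set.toFinite _)
  by_contra hne
  have : L.parallelClass e ∈ sepClasses S R := by
    rw [h1]
    exact Or.inl ⟨e, Ne.symm hne, rfl⟩
  exact mem_sepClasses.1 this he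

theorem sepCard_add {S T R : L.Tope} (h : ∀ e, S.sign e = R.sign e → T.sign e = S.sign e) :
    sepCard S T + sepCard T R = sepCard S R := by
  have hdisj : Disjoint (sepClasses S T) (sepClasses T R) := by
    rw [Set.disjoint_left]
    rintro _ ⟨e, he, rfl⟩ h2
    rw [mem_sepClasses] at h2
    have h0 := S.isTope.ne_zero_of_ne T.isTope he
    have h0' := S.isTope.ne_zero T.isTope h0
    have h0'' := S.isTope.ne_zero R.isTope h0
    refine he (h e ?_).symm
    rw [SignType.eq_neg_of_ne h0 h0' he, SignType.eq_neg_of_ne h0' h0'' h2, neg_neg]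
  rw [sepCard, sepCard, sepCard, ← Set.ncard_union_eq hdisj (Set.toFinite _) (Set.toFinite _)]
  refine le_antisymm (Set.ncard_le_ncard ?_ (Set.toFinite _))
    (Set.ncard_le_ncard (sepClasses_subset_union S T R) (Set.toFinite _))
  rintro _ (⟨e, he, rfl⟩ | ⟨e, he, rfl⟩)
  · exact ⟨e, fun h' => he (h e h').symm, rfl⟩
  · exact ⟨e, fun h' => he ((h e h').trans h'), rfl⟩

/-- Adjacent topes are separated by exactly one parallel class. -/
theorem exists_parallelClass_of_adj {S T : L.Tope} (h : L.topeGraph.Adj S T) :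
    ∃ e, S.sign e ≠ T.sign e ∧
      ∀ f, S.sign f ≠ T.sign f → L.parallelClass f = L.parallelClass e := by
  obtain ⟨X, hX, hT⟩ := topeGraph_adj_iff.1 h
  obtain ⟨e, he, hSe⟩ := hX.2.1.exists_zero hX.2.2.1
  refine ⟨e, ?_, fun f hf => ?_⟩
  · rw [hT, signComp_of_zero _ he]
    exact SignType.ne_neg_self hSe
  · refine (hX.eq_zero_iff_parallelClass S.isTope he hSe f).1 ⟨?_, S.isTope.ne_zero_of_ne T.isTope hf⟩
    by_contra h0
    rw [hT, signComp_of_ne _ h0, hX.2.1.eq_of_ne h0] at hf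
    exact hf rfl

theorem sepCard_of_adj {S T : L.Tope} (h : L.topeGraph.Adj S T) : sepCard S T = 1 := by
  obtain ⟨e, he, hc⟩ := exists_parallelClass_of_adj h
  rw [sepCard, Set.ncard_eq_one]
  refine ⟨L.parallelClass e, Set.eq_singleton_iff_unique_mem.2 ⟨⟨e, he, rfl⟩, ?_⟩⟩
  rintro _ ⟨f, hf, rfl⟩
  exact hc f hf

theorem sepCard_of_adj_of_ne {S T R : L.Tope} (h : L.topeGraph.Adj S T) {e : E}
    (he : S.sign e ≠ T.sign e) (hR : S.sign e ≠ R.sign e) : sepCard S R = sepCard T R + 1 := by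
  have h1 : sepCard S T + sepCard T R = sepCard S R := by
    refine sepCard_add fun f hf => ?_
    by_contra hne
    obtain ⟨g, hg, hc⟩ := exists_parallelClass_of_adj h
    exact S.isTope.ne_of_parallelClass_eq R.isTope ((hc e he).trans (hc f (Ne.symm hne)).symm) hR hf
  rw [← h1, sepCard_of_adj h, add_comm]

theorem sepCard_of_adj_of_eq {S T R : L.Tope} (h : L.topeGraph.Adj S T) {e : E}
    (he : S.sign e ≠ T.sign e) (hR : S.sign e = R.sign e) : sepCard T R = sepCard S R + 1 :=
  sepCard_of_adj_of_ne h.symm he.symm (by rw [← hR]; exact he.symm)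

theorem sepCard_le_length {S T : L.Tope} (p : L.Gallery S T) : sepCard S T ≤ p.length := by
  induction p with
  | nil => simp
  | @cons S R T h p ih =>
    have := sepCard_triangle S R T
    rw [sepCard_of_adj h] at this
    rw [SimpleGraph.Walk.length_cons]
    omega

theorem exists_adj_of_ne {S T : L.Tope} (hne : S ≠ T) :
    ∃ R, L.topeGraph.Adj S R ∧ sepCard S T = sepCard R T + 1 := by
  obtain ⟨X, hX, hsep⟩ := exists_facet_separating S.isTope T.isTope
    fun h => hne (Tope.sign_injective h)
  have hR := S.isTope.comp_neg hX.1
  have hadj : L.topeGraph.Adj S hR.toTope := topeGraph_adj_iff.2 ⟨X, hX, rfl⟩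
  obtain ⟨e, he, hSe⟩ := hX.2.1.exists_zero hX.2.2.1
  refine ⟨_, hadj, sepCard_of_adj_of_ne hadj (e := e) ?_ ?_⟩
  · rw [IsTope.sign_toTope, signComp_of_zero _ he]
    exact SignType.ne_neg_self hSe
  · intro h
    have h1 := hsep e he
    rw [h] at h1 hSe
    exact SignType.ne_neg_self hSe h1

theorem exists_length_eq_sepCard (S T : L.Tope) : ∃ p : L.Gallery S T, p.length = sepCard S T := by
  induction hn : sepCard S T generalizing S with
  | zero =>
    obtain rfl := sepCard_eq_zero.1 hn
    exact ⟨.nil, rfl⟩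
  | succ n ih =>
    obtain ⟨R, hadj, hR⟩ := exists_adj_of_ne (S := S) (T := T) fun h => by
      rw [sepCard_eq_zero.2 h] at hn
      omega
    obtain ⟨p, hp⟩ := ih R (by omega)
    exact ⟨.cons hadj p, by rw [SimpleGraph.Walk.length_cons, hp]⟩

theorem isReduced_iff {S T : L.Tope} {p : L.Gallery S T} :
    L.IsReduced p ↔ p.length = sepCard S T := by
  constructor
  · intro h
    obtain ⟨q, hq⟩ := exists_length_eq_sepCard S T
    exact le_antisymm (hq ▸ h q) (sepCard_le_length p)
  · intro h q
    rw [h]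
    exact sepCard_le_length q

theorem dist_eq_sepCard (S T : L.Tope) : L.topeGraph.dist S T = sepCard S T := by
  obtain ⟨q, hq⟩ := exists_length_eq_sepCard S T
  refine le_antisymm (hq ▸ SimpleGraph.dist_le q) ?_
  obtain ⟨p, hp⟩ := (SimpleGraph.Walk.reachable q).exists_walk_length_eq_dist
  exact hp ▸ sepCard_le_length p

theorem IsReduced.isPath {S T : L.Tope} {p : L.Gallery S T} (hp : L.IsReduced p) : p.IsPath :=
  p.isPath_of_length_eq_dist (by rw [dist_eq_sepCard, isReduced_iff.1 hp])

theorem isReduced_append {S R T : L.Tope} {p : L.Gallery S R} {q : L.Gallery R T} :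
    L.IsReduced (p.append q) ↔
      L.IsReduced p ∧ L.IsReduced q ∧ sepCard S R + sepCard R T = sepCard S T := by
  have h1 := sepCard_le_length p
  have h2 := sepCard_le_length q
  have h3 := sepCard_triangle S R T
  simp only [isReduced_iff, SimpleGraph.Walk.length_append]
  omega

theorem isReduced_cons {S R T : L.Tope} {h : L.topeGraph.Adj S R} {q : L.Gallery R T} :
    L.IsReduced (q.cons h) ↔ L.IsReduced q ∧ sepCard S T = sepCard R T + 1 := by
  have h1 := sepCard_le_length q
  have h3 := sepCard_triangle S R T
  rw [sepCard_of_adj h] at h3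
  simp only [isReduced_iff, SimpleGraph.Walk.length_cons]
  omega

theorem IsReduced.sign_eq {S R T : L.Tope} {p : L.Gallery S T} (hp : L.IsReduced p)
    (hR : R ∈ p.support) {e : E} (he : S.sign e = T.sign e) : R.sign e = S.sign e := by
  obtain ⟨q, r, rfl⟩ := SimpleGraph.Walk.mem_support_iff_exists_append.1 hR
  exact eq_of_sepCard_add (isReduced_append.1 hp).2.2 he

end

/-- A reduced gallery keeps every sign shared by its ends, so the topes above `G` form a convex set.
-/
theorem IsReduced.signLE [Finite E] {G : E → SignType} {S R T : L.Tope} {p : L.Gallery S T}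
    (hp : L.IsReduced p) (hR : R ∈ p.support) (hS : SignLE G S.sign) (hT : SignLE G T.sign) :
    SignLE G R.sign := by
  intro e
  by_cases h : G e = 0
  · exact Or.inl h
  · right
    rw [hp.sign_eq hR (by rw [hS.eq_of_ne h, hT.eq_of_ne h]), hS.eq_of_ne h]

theorem SignLE.eq_zero_of_ne {G X Y : E → SignType} (hX : SignLE G X) (hY : SignLE G Y) {e : E}
    (h : X e ≠ Y e) : G e = 0 := by
  by_contra h0
  exact h (by rw [hX.eq_of_ne h0, hY.eq_of_ne h0])

/-! ### Reduced galleries around a coline -/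

/-- A tope above a coline has at most two neighbours above it. -/
theorem IsColine.adj_eq_or [Finite E] {G : E → SignType} (hG : L.IsColine G) {S T₁ T₂ T₃ : L.Tope}
    (hS : SignLE G S.sign) (h₁ : L.topeGraph.Adj S T₁) (h₂ : L.topeGraph.Adj S T₂)
    (h₃ : L.topeGraph.Adj S T₃) (hG₁ : SignLE G T₁.sign) (hG₂ : SignLE G T₂.sign)
    (hG₃ : SignLE G T₃.sign) (hne : T₁ ≠ T₂) : T₃ = T₁ ∨ T₃ = T₂ := by
  obtain ⟨F₁, hF₁, e₁⟩ := topeGraph_adj_iff.1 h₁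
  obtain ⟨F₂, hF₂, e₂⟩ := topeGraph_adj_iff.1 h₂
  obtain ⟨F₃, hF₃, e₃⟩ := topeGraph_adj_iff.1 h₃
  rcases hG.facet_eq_or S.isTope hF₁ hF₂ hF₃ (hF₁.le_of_le_of_le_comp_neg hS (e₁ ▸ hG₁))
    (hF₂.le_of_le_of_le_comp_neg hS (e₂ ▸ hG₂)) (hF₃.le_of_le_of_le_comp_neg hS (e₃ ▸ hG₃))
    (fun h => hne (Tope.sign_injective (by rw [e₁, e₂, h]))) with h | h
  · left; apply Tope.sign_injective; rw [e₃, e₁, h]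
  · right; apply Tope.sign_injective; rw [e₃, e₂, h]

/-- Around a coline, reduced galleries are determined by their direction. -/
theorem IsColine.reduced_unique [Finite E] {G : E → SignType} (hG : L.IsColine G)
    {A B C : L.Tope} (hAC : L.topeGraph.Adj A C) (hA : SignLE G A.sign) (hB : SignLE G B.sign)
    (hC : SignLE G C.sign) {e : E} (he : A.sign e ≠ C.sign e) (he' : A.sign e = B.sign e)
    (p q : L.Gallery A B) (hp : L.IsReduced p) (hq : L.IsReduced q) : p = q := by
  induction p generalizing C e with
  | nil =>
    cases q with
    | nil => rfl
    | cons h q =>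
      have := isReduced_iff.1 hq
      simp at this
  | @cons A A₁ B h p ih =>
    cases q with
    | nil =>
      have := isReduced_iff.1 hp
      simp at this
    | @cons _ A₂ _ h' q =>
      have hm₁ : A₁ ∈ (p.cons h).support := by simp
      have hm₂ : A₂ ∈ (q.cons h').support := by simp
      have h₁ := hp.signLE hm₁ hA hB
      have h₂ := hq.signLE hm₂ hA hB
      have hne₁ : A₁ ≠ C := fun hc => he (by rw [← hc, hp.sign_eq hm₁ he'])
      have hne₂ : A₂ ≠ C := fun hc => he (by rw [← hc, hq.sign_eq hm₂ he'])
      -- `C` lies across a wall that a reduced gallery to `B` never crosses, so only one neighbour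
      -- above `G` remains. For the next step, `A` plays the part of `C`.
      obtain rfl : A₂ = A₁ :=
        (hG.adj_eq_or hA h hAC h' h₁ hC h₂ hne₁).resolve_right hne₂
      obtain ⟨f, hf, -⟩ := exists_parallelClass_of_adj h
      have hpr := isReduced_cons.1 hp
      have hqr := isReduced_cons.1 hq
      have hf' : A₂.sign f = B.sign f := by
        by_contra hc
        have := sepCard_of_adj_of_ne h.symm hf.symm hc
        omega
      rw [ih h.symm h₁ hB hA hf.symm hf' q hpr.1 hqr.1]

section

variable [Finite E] {G : E → SignType} {Q Q₁ Q₂ T : L.Tope}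

theorem IsColine.reduced_eq_or (hG : L.IsColine G) (hQ : SignLE G Q.sign)
    (hT : T.sign = signComp G (-Q.sign)) (h₁ : L.topeGraph.Adj Q Q₁) (h₂ : L.topeGraph.Adj Q Q₂)
    (hG₁ : SignLE G Q₁.sign) (hG₂ : SignLE G Q₂.sign) (hne : Q₁ ≠ Q₂)
    {p₁ : L.Gallery Q₁ T} {p₂ : L.Gallery Q₂ T} (hp₁ : L.IsReduced (p₁.cons h₁))
    (hp₂ : L.IsReduced (p₂.cons h₂)) {q : L.Gallery Q T} (hq : L.IsReduced q) :
    q = p₁.cons h₁ ∨ q = p₂.cons h₂ := by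
  have hGT : SignLE G T.sign := hT ▸ signLE_comp _ _
  have key : ∀ {R : L.Tope} (h : L.topeGraph.Adj Q R) (r r' : L.Gallery R T), SignLE G R.sign →
      L.IsReduced r → L.IsReduced r' → r = r' := by
    intro R h r r' hR hr hr'
    obtain ⟨f, hf, -⟩ := exists_parallelClass_of_adj h
    refine hG.reduced_unique h.symm hR hGT hQ hf.symm ?_ r r' hr hr'
    have h0 := Q.isTope.ne_zero_of_ne R.isTope hf
    rw [hT, signComp_of_zero _ (hQ.eq_zero_of_ne hR hf), Pi.neg_apply,
      SignType.eq_neg_of_ne h0 (Q.isTope.ne_zero R.isTope h0) hf, neg_neg]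
  cases q with
  | nil =>
    have := isReduced_iff.1 hp₁
    simp at this
  | @cons _ R _ h r =>
    have hR := hq.signLE (R := R) (by simp) hQ hGT
    rcases hG.adj_eq_or hQ h₁ h₂ h hG₁ hG₂ hR hne with rfl | rfl
    · left
      rw [key h r p₁ hR (isReduced_cons.1 hq).1 (isReduced_cons.1 hp₁).1]
    · right
      rw [key h r p₂ hR (isReduced_cons.1 hq).1 (isReduced_cons.1 hp₂).1]

theorem IsReduced.ne_of_mem_support {h₁ : L.topeGraph.Adj Q Q₁} {p₁ : L.Gallery Q₁ T}
    (hp : L.IsReduced (p₁.cons h₁)) {S : L.Tope} (hS : S ∈ p₁.support) {e : E}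
    (he : Q.sign e ≠ Q₁.sign e) : Q.sign e ≠ S.sign e := by
  obtain ⟨a, b, rfl⟩ := SimpleGraph.Walk.mem_support_iff_exists_append.1 hS
  rw [← SimpleGraph.Walk.cons_append] at hp
  intro h
  exact he ((isReduced_append.1 hp).1.sign_eq (R := Q₁) (by simp) h).symm

/-- The walls of `T` through `G` are those of `Q`, by reflection in `G`. If `S` were not `T`, one of
them would separate the two and leave `S` on the side of `Q`. -/
theorem IsColine.eq_of_ne_of_ne (hG : L.IsColine G) (hQ : SignLE G Q.sign)
    (hT : T.sign = signComp G (-Q.sign)) (h₁ : L.topeGraph.Adj Q Q₁) (h₂ : L.topeGraph.Adj Q Q₂)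
    (hG₁ : SignLE G Q₁.sign) (hG₂ : SignLE G Q₂.sign) (hne : Q₁ ≠ Q₂) {S : L.Tope}
    (hS : SignLE G S.sign) (hS₁ : ∀ e, Q.sign e ≠ Q₁.sign e → Q.sign e ≠ S.sign e)
    (hS₂ : ∀ e, Q.sign e ≠ Q₂.sign e → Q.sign e ≠ S.sign e) : S = T := by
  by_contra hST
  obtain ⟨Y, hY, hsep⟩ := exists_facet_separating T.isTope S.isTope
    fun h => hST (Tope.sign_injective h.symm)
  have hGT : SignLE G T.sign := hT ▸ signLE_comp _ _
  have hGY : SignLE G Y := by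
    intro g
    by_cases hg : G g = 0
    · exact Or.inl hg
    · right
      have hYg : Y g ≠ 0 := by
        intro h0
        have h1 := hsep g h0
        rw [hGT.eq_of_ne hg, hS.eq_of_ne hg] at h1
        exact SignType.ne_neg_self hg h1
      rw [← hY.2.1.eq_of_ne hYg, hGT.eq_of_ne hg]
  have hN := hY.comp_neg hG.mem hGY
  rw [hT, signComp_neg_comp_neg hQ] at hN
  have hC := Q.isTope.comp_neg hN.1
  have hadj : L.topeGraph.Adj Q hC.toTope := topeGraph_adj_iff.2 ⟨_, hN, rfl⟩
  obtain ⟨e, he, -⟩ := exists_parallelClass_of_adj hadj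
  have hGC : SignLE G hC.toTope.sign := (signLE_comp G (-Y)).trans (signLE_comp _ _)
  have hGe := hQ.eq_zero_of_ne hGC he
  have hYe : Y e = 0 := by
    by_contra h0
    have hne : signComp G (-Y) e ≠ 0 := by
      rw [signComp_of_zero _ hGe, Pi.neg_apply]
      simpa using h0
    rw [IsTope.sign_toTope, signComp_of_ne _ hne] at he
    exact he (hN.2.1.eq_of_ne hne)
  have hQS : Q.sign e = S.sign e := by
    have h1 := hsep e hYe
    rw [hT, signComp_of_zero _ hGe, Pi.neg_apply] at h1
    exact neg_injective h1
  rcases hG.adj_eq_or hQ h₁ h₂ hadj hG₁ hG₂ hGC hne with h | h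
  · exact hS₁ e (h ▸ he) hQS
  · exact hS₂ e (h ▸ he) hQS

/-- The two reduced galleries going around a coline form a polygon. -/
theorem IsColine.isPolygon {X : L.Covector} (hX : L.corank X = 2) (hG : L.IsColine X.val)
    (hQ : SignLE X.val Q.sign)
    (hT : T.sign = signComp X.val (-Q.sign)) (h₁ : L.topeGraph.Adj Q Q₁) (h₂ : L.topeGraph.Adj Q Q₂)
    (hG₁ : SignLE X.val Q₁.sign) (hG₂ : SignLE X.val Q₂.sign) (hne : Q₁ ≠ Q₂)
    {p₁ : L.Gallery Q₁ T} {p₂ : L.Gallery Q₂ T} (hp₁ : L.IsReduced (p₁.cons h₁))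
    (hp₂ : L.IsReduced (p₂.cons h₂)) :
    L.IsPolygon ((p₁.cons h₁).append (p₂.cons h₂).reverse) := by
  have hGT : SignLE X.val T.sign := hT ▸ signLE_comp _ _
  have hdisj : ∀ S, S ∈ p₁.support → S ∈ p₂.support → S = T := fun S hS₁ hS₂ =>
    hG.eq_of_ne_of_ne hQ hT h₁ h₂ hG₁ hG₂ hne (hp₁.signLE (by simp [hS₁]) hQ hGT)
      (fun _ he => hp₁.ne_of_mem_support hS₁ he) (fun _ he => hp₂.ne_of_mem_support hS₂ he)
  have hpath₁ := hp₁.isPath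
  have hpath₂ := hp₂.isPath
  have hQ₁T : Q₁ ≠ T := by
    rintro rfl
    have h3 := sepCard_of_adj h₁
    have h4 := (isReduced_cons.1 hp₂).2
    rw [h3] at h4
    exact hne (sepCard_eq_zero.1 (by omega)).symm
  refine ⟨?_, X, hX, fun S => ?_⟩
  · rw [SimpleGraph.Walk.cons_append, SimpleGraph.Walk.cons_isCycle_iff]
    constructor
    · rw [SimpleGraph.Walk.isPath_def, SimpleGraph.Walk.support_append,
        SimpleGraph.Walk.support_reverse]
      rw [SimpleGraph.Walk.isPath_def] at hpath₁ hpath₂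
      have hn₂ := List.nodup_reverse.2 hpath₂
      rw [SimpleGraph.Walk.support_cons] at hpath₁
      have hsupp : (p₂.cons h₂).support.reverse = T :: (p₂.cons h₂).support.reverse.tail := by
        rw [← SimpleGraph.Walk.support_reverse]
        exact (SimpleGraph.Walk.cons_tail_support _).symm
      rw [hsupp] at hn₂
      refine List.Nodup.append (List.nodup_cons.1 hpath₁).2 (List.nodup_cons.1 hn₂).2 ?_
      intro S hS₁ hS₂
      have hS₃ : S ∈ (p₂.cons h₂).support := List.mem_reverse.1 (List.mem_of_mem_tail hS₂)
      rw [SimpleGraph.Walk.support_cons, List.mem_cons] at hS₃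
      rcases hS₃ with rfl | hS₃
      · exact (List.nodup_cons.1 hpath₁).1 hS₁
      · rw [hdisj S hS₁ hS₃] at hS₂
        exact (List.nodup_cons.1 hn₂).1 hS₂
    · rw [SimpleGraph.Walk.edges_append, List.mem_append, SimpleGraph.Walk.edges_reverse,
        List.mem_reverse]
      rintro (h | h)
      · exact ((SimpleGraph.Walk.cons_isPath_iff _ _).1 hpath₁).2
          (SimpleGraph.Walk.fst_mem_support_of_mem_edges _ h)
      · have h3 := SimpleGraph.Walk.snd_mem_support_of_mem_edges _ h
        rw [SimpleGraph.Walk.support_cons, List.mem_cons] at h3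
        rcases h3 with h3 | h3
        · exact h₁.ne h3.symm
        · exact hQ₁T (hdisj _ (SimpleGraph.Walk.start_mem_support _) h3)
  · have hface : L.face X ⊆ L.face S.1 ↔ SignLE X.val S.sign :=
      ⟨fun h => h (le_refl X), fun h _ hY => le_trans (α := L.Covector) hY h⟩
    rw [hface, SimpleGraph.Walk.mem_support_append_iff, SimpleGraph.Walk.support_reverse,
      List.mem_reverse]
    constructor
    · rintro (h | h)
      · exact hp₁.signLE h hQ hGT
      · exact hp₂.signLE h hQ hGT
    -- As `T` is opposite `Q` at `G`, every tope above `G` lies on a reduced gallery from `Q` to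
    -- `T`, and there are only two of these.
    · intro hS
      obtain ⟨a, ha⟩ := exists_length_eq_sepCard Q S
      obtain ⟨b, hb⟩ := exists_length_eq_sepCard S T
      have hab : L.IsReduced (a.append b) := by
        refine isReduced_append.2 ⟨isReduced_iff.2 ha, isReduced_iff.2 hb, sepCard_add fun e he => ?_⟩
        by_cases h0 : X.val e = 0
        · rw [hT, signComp_of_zero _ h0, Pi.neg_apply] at he
          by_contra hc
          exact SignType.ne_neg_self (Q.isTope.ne_zero_of_ne S.isTope (Ne.symm hc)) he
        · rw [hS.eq_of_ne h0, hQ.eq_of_ne h0]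
      have hSm : S ∈ (a.append b).support := by simp
      rcases hG.reduced_eq_or hQ hT h₁ h₂ hG₁ hG₂ hne hp₁ hp₂ hab with h | h
      · exact Or.inl (h ▸ hSm)
      · exact Or.inr (h ▸ hSm)

end

/-! ### Moves between reduced galleries -/

/-- A finite sequence of braid and nil moves. -/
abbrev Moves (L : OrientedMatroid E) {Q R : L.Tope} (γ γ' : L.Gallery Q R) : Prop :=
  Relation.ReflTransGen (fun α β : L.Gallery Q R => L.BraidMove α β ∨ L.NilMove α β) γ γ'

theorem Moves.append {Q S T R : L.Tope} (a : L.Gallery Q S) {p p' : L.Gallery S T}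
    (b : L.Gallery T R) (h : L.Moves p p') :
    L.Moves (a.append (p.append b)) (a.append (p'.append b)) := by
  refine Relation.ReflTransGen.lift (fun p : L.Gallery S T => a.append (p.append b)) ?_ _ _ h
  rintro α β (⟨S', T', a', p, p', b', hl, hpoly, rfl, rfl⟩ | ⟨S', T', hadj, a', b', rfl, rfl⟩)
  · exact Or.inl ⟨S', T', a.append a', p, p', b'.append b, hl, hpoly,
      by simp only [SimpleGraph.Walk.append_assoc], by simp only [SimpleGraph.Walk.append_assoc]⟩
  · refine Or.inr ⟨S', T', hadj, a.append a', b'.append b, ?_, ?_⟩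
    · simp only [← SimpleGraph.Walk.append_assoc, SimpleGraph.Walk.cons_append]
    · simp only [SimpleGraph.Walk.append_assoc]

theorem Moves.cons {Q S R : L.Tope} (h : L.topeGraph.Adj Q S) {p p' : L.Gallery S R}
    (hp : L.Moves p p') : L.Moves (p.cons h) (p'.cons h) := by
  simpa using hp.append (.cons h .nil) .nil

theorem Moves.append_right {Q S R : L.Tope} {p p' : L.Gallery Q S} (hp : L.Moves p p')
    (b : L.Gallery S R) : L.Moves (p.append b) (p'.append b) := by
  simpa using hp.append .nil b

theorem moves_of_reduced [Finite E] {Q R : L.Tope} (p q : L.Gallery Q R) (hp : L.IsReduced p)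
    (hq : L.IsReduced q) : L.Moves p q := by
  induction hn : sepCard Q R using Nat.strong_induction_on generalizing Q R with
  | _ n ih =>
  have hpl := isReduced_iff.1 hp
  have hql := isReduced_iff.1 hq
  -- galleries with a common first step
  have hfirst : ∀ {S : L.Tope} (h : L.topeGraph.Adj Q S) (a b : L.Gallery S R),
      L.IsReduced (a.cons h) → L.IsReduced (b.cons h) → L.Moves (a.cons h) (b.cons h) := by
    intro S h a b ha hb
    have ha' := isReduced_cons.1 ha
    exact (ih _ (by omega) a b ha'.1 (isReduced_cons.1 hb).1 rfl).cons h
  cases hq' : q with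
  | nil =>
    subst hq'
    cases p with
    | nil => exact .refl
    | cons h p => simp at hpl
  | @cons _ Q₁ _ hQ q₁ =>
  subst hq'
  obtain ⟨R', p₀, hR, rfl⟩ : ∃ (R' : L.Tope) (p₀ : L.Gallery Q R') (hR : L.topeGraph.Adj R' R),
      p = p₀.append (.cons hR .nil) := by
    cases p with
    | nil => simp at hql
    | cons h p =>
      obtain ⟨R', p₀, hR, h'⟩ := SimpleGraph.Walk.exists_cons_eq_concat h p
      exact ⟨R', p₀, hR, h'⟩
  obtain ⟨hp₀, -, hadd⟩ := isReduced_append.1 hp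
  have hR1 := sepCard_of_adj hR
  obtain ⟨e, he, hclass⟩ := exists_parallelClass_of_adj hR
  have hQR' : Q.sign e = R'.sign e := by
    by_contra hc
    have h1 := sepCard_of_adj_of_ne (R := Q) hR he (Ne.symm hc)
    rw [sepCard_comm R' Q, sepCard_comm R Q] at h1
    omega
  -- galleries whose first step does not cross the last wall of `p`
  have hcase : ∀ {S : L.Tope} (h : L.topeGraph.Adj Q S) (b : L.Gallery S R),
      L.IsReduced (b.cons h) → Q.sign e = S.sign e →
      L.Moves (p₀.append (.cons hR .nil)) (b.cons h) := by
    intro S h b hb hS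
    have hb' := isReduced_cons.1 hb
    have h2 : sepCard R S = sepCard R' S + 1 :=
      sepCard_of_adj_of_eq hR he (by rw [← hQR', hS])
    rw [sepCard_comm R S, sepCard_comm R' S] at h2
    -- The intermediate gallery passes through `S` and `R'`: it shares its last step with `p` and
    -- its first with `b`.
    obtain ⟨r, hr⟩ := exists_length_eq_sepCard S R'
    have hσ : L.IsReduced ((r.append (.cons hR .nil)).cons h) := by
      rw [isReduced_iff]
      simp only [SimpleGraph.Walk.length_cons, SimpleGraph.Walk.length_append,
        SimpleGraph.Walk.length_nil]
      omega
    refine Relation.ReflTransGen.trans ?_ (hfirst h _ _ hσ hb)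
    rw [← SimpleGraph.Walk.cons_append] at hσ ⊢
    exact Moves.append_right (ih _ (by omega) p₀ _ hp₀ (isReduced_append.1 hσ).1 rfl) _
  by_cases hQ₁e : Q.sign e = Q₁.sign e
  · exact hcase hQ q₁ hq hQ₁e
  have hq₁ := isReduced_cons.1 hq
  obtain ⟨F, hF, hQ₁⟩ := topeGraph_adj_iff.1 hQ
  obtain ⟨X, hX, hRX⟩ := topeGraph_adj_iff.1 hR
  have hQe := Q.isTope.ne_zero_of_ne Q₁.isTope hQ₁e
  have hFe : F e = 0 := by
    by_contra h0
    rw [hQ₁, signComp_of_ne _ h0, hF.2.1.eq_of_ne h0] at hQ₁e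
    exact hQ₁e rfl
  have hXe : X e = 0 := by
    by_contra h0
    rw [hRX, signComp_of_ne _ h0, hX.2.1.eq_of_ne h0] at he
    exact he rfl
  have hR'e : R'.sign e ≠ 0 := hQR' ▸ hQe
  have hFt := hF.isTope_contract Q.isTope hFe hQe
  have hXt := hX.isTope_contract R'.isTope hXe hR'e
  by_cases hFX : F = X
  · have hQR : Q = R' := by
      apply Tope.sign_injective
      subst hFX
      rcases hF.eq_or Q.isTope R'.isTope.1 hX.2.1 with h | h | h
      · exact absurd h.symm hX.2.2.1
      · exact h.symm
      · rw [h, signComp_of_zero _ hFe] at hQR'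
        exact absurd hQR' (SignType.ne_neg_self hQe)
    subst hQR
    obtain rfl : Q₁ = R := Tope.sign_injective (by rw [hQ₁, hRX, hFX])
    have hpn := isReduced_iff.1 hp₀
    have hqn := isReduced_iff.1 hq₁.1
    cases p₀ with
    | cons h p => simp at hpn
    | nil =>
      cases q₁ with
      | cons h p => simp at hqn
      | nil => exact .refl
  -- Separation here takes place in the contraction at `e`: `F` and `X` are opposite wherever `G`
  -- vanishes.
  obtain ⟨G, hGF', hGsep⟩ := exists_facet_separating hFt hXt hFX
  have hGF := (facet_contract_iff hFe).1 hGF'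
  have hcol := hF.isColine Q.isTope hGF
  obtain ⟨F', hF', hGF₂, hFne⟩ := hcol.exists_facet_ne Q.isTope hF hGF.2.1
  have hGQ := hGF.2.1.trans hF.2.1
  have hTt := Q.isTope.comp_neg hGF.1
  have hQ₂t := Q.isTope.comp_neg hF'.1
  let T : L.Tope := hTt.toTope
  let Q₂ : L.Tope := hQ₂t.toTope
  have hTs : T.sign = signComp G (-Q.sign) := rfl
  have hQ₂s : Q₂.sign = signComp F' (-Q.sign) := rfl
  have hQ' : L.topeGraph.Adj Q Q₂ := topeGraph_adj_iff.2 ⟨F', hF', rfl⟩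
  have hF'e : F' e ≠ 0 := fun h => hFne (hF'.eq_of_common_zero Q.isTope hF h hFe hQe)
  have hQ₂e : Q.sign e = Q₂.sign e := by
    rw [hQ₂s, signComp_of_ne _ hF'e, hF'.2.1.eq_of_ne hF'e]
  have hne : Q₂ ≠ Q₁ := fun h => hQ₁e (by rw [hQ₂e, h])
  have hG₁ : SignLE G Q₁.sign := by rw [hQ₁]; exact hGF.2.1.trans (signLE_comp _ _)
  have hG₂ : SignLE G Q₂.sign := hGF₂.trans (signLE_comp _ _)
  -- every wall through `G` separates `Q` from `R`
  have hGR : ∀ g, G g = 0 → Q.sign g ≠ 0 → Q.sign g ≠ R.sign g := by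
    intro g hg hQg
    by_cases hFg : F g = 0
    · have h1 := (hF.eq_zero_iff_parallelClass Q.isTope hFe hQe g).1 ⟨hFg, hQg⟩
      refine Q.isTope.ne_of_parallelClass_eq R.isTope h1.symm ?_
      rw [hQR']
      exact he
    · have h1 := hGsep g hg
      have hXg : X g ≠ 0 := fun h => hFg (by rw [h1, h, neg_zero])
      rw [hF.2.1.eq_of_ne hFg, hRX, signComp_of_ne _ hXg, h1]
      exact (SignType.ne_neg_self hXg).symm
  have hQT : ∀ {S : L.Tope}, SignLE G S.sign → sepCard Q S + sepCard S T = sepCard Q T := by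
    intro S hS
    refine sepCard_add fun g hg => ?_
    by_cases h0 : G g = 0
    · rw [hTs, signComp_of_zero _ h0, Pi.neg_apply] at hg
      by_contra hc
      exact SignType.ne_neg_self (Q.isTope.ne_zero_of_ne S.isTope (Ne.symm hc)) hg
    · rw [hS.eq_of_ne h0, hGQ.eq_of_ne h0]
  have hTR : sepCard Q T + sepCard T R = sepCard Q R := by
    refine sepCard_add fun g hg => ?_
    by_cases h0 : G g = 0
    · by_cases hQg : Q.sign g = 0
      · rw [hQg, Q.isTope.eq_zero T.isTope.1 hQg]
      · exact absurd hg (hGR g h0 hQg)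
    · rw [hTs, signComp_of_ne _ h0, hGQ.eq_of_ne h0]
  obtain ⟨p₁, hp₁⟩ := exists_length_eq_sepCard Q₁ T
  obtain ⟨p₂, hp₂⟩ := exists_length_eq_sepCard Q₂ T
  obtain ⟨r, hr⟩ := exists_length_eq_sepCard T R
  have hred : ∀ {S : L.Tope} (h : L.topeGraph.Adj Q S) (a : L.Gallery S T), SignLE G S.sign →
      a.length = sepCard S T → L.IsReduced (a.cons h) := by
    intro S h a hS ha
    have h1 := hQT hS
    rw [sepCard_of_adj h] at h1
    exact isReduced_cons.2 ⟨isReduced_iff.2 ha, by omega⟩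
  have hr₁ := hred hQ p₁ hG₁ hp₁
  have hr₂ := hred hQ' p₂ hG₂ hp₂
  have hσ₁ := isReduced_append.2 ⟨hr₁, isReduced_iff.2 hr, hTR⟩
  have hσ₂ := isReduced_append.2 ⟨hr₂, isReduced_iff.2 hr, hTR⟩
  have hbraid : L.BraidMove ((p₂.cons hQ').append r) ((p₁.cons hQ).append r) := by
    refine ⟨Q, T, .nil, p₂.cons hQ', p₁.cons hQ, r, ?_, ?_, rfl, rfl⟩
    · rw [isReduced_iff.1 hr₁, isReduced_iff.1 hr₂]
    · exact IsColine.isPolygon (X := ⟨G, hGF.1⟩)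
        (IsColine.corank_eq_two (X := ⟨G, hGF.1⟩) Q.isTope hF hGF hcol) hcol hGQ hTs hQ' hQ hG₂ hG₁
        hne hr₂ hr₁
  rw [SimpleGraph.Walk.cons_append] at hσ₁ hσ₂
  -- The gallery through `Q₂` does not cross `e` first, so the easy case reaches it; the braid move
  -- then gives a gallery with the first step of `q`.
  exact ((hcase hQ' _ hσ₂ hQ₂e).tail (Or.inl hbraid)).trans (hfirst hQ _ _ hσ₁ hq)

end OrientedMatroid

/-! ### Path convexity -/

theorem theorem5p4 {E : Type*} [Finite E] (L : OrientedMatroid E) : L.PathConvex := by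
  intro Q R γ
  induction γ with
  | nil => exact fun ρ hρ => OrientedMatroid.moves_of_reduced _ _ (fun _ => Nat.zero_le _) hρ
  | @cons Q S R h p ih =>
    intro ρ hρ
    obtain ⟨e, he, -⟩ := OrientedMatroid.exists_parallelClass_of_adj h
    by_cases hR : Q.sign e = R.sign e
    · have h1 := OrientedMatroid.sepCard_of_adj_of_eq h he hR
      -- The first step leaves the side of its wall containing `R`, so stepping back and following
      -- `ρ` is reduced; the tail moves to that, and a nil move cancels the detour.
      have h2 : L.IsReduced (.cons h.symm ρ) :=
        OrientedMatroid.isReduced_cons.2 ⟨hρ, h1⟩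
      exact (OrientedMatroid.Moves.cons h (ih _ h2)).tail
        (Or.inr ⟨Q, S, h, .nil, ρ, rfl, rfl⟩)
    · have h1 := OrientedMatroid.sepCard_of_adj_of_ne h he hR
      obtain ⟨q, hq⟩ := OrientedMatroid.exists_length_eq_sepCard S R
      have hq' := OrientedMatroid.isReduced_iff.2 hq
      exact (OrientedMatroid.Moves.cons h (ih q hq')).trans
        (OrientedMatroid.moves_of_reduced _ _ (OrientedMatroid.isReduced_cons.2 ⟨hq', h1⟩) hρ)
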